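/- Let $L\in\mathbb{C}^{(d+1)\times(n+1)}$ be a matrix none of whose columns is zero, and let $\ell_0,\dots,\ell_n$ be the affine-linear functions on $\mathbb{C}^d$ given by $(\ell_0(x),\dots,\ell_n(x))=(1,x_1,\dots,x_d)\cdot L$. Let $\mathcal{R}_L\subset\mathbb{P}^n$ be the reciprocal linear space of $L$, i.e. the Zariski closure of the image of $\phi\colon\{x\in\mathbb{C}^d:\ell_0(x)\cdots\ell_n(x)\neq 0\}\to\mathbb{P}^n$, $x\mapsto(\ell_0(x)^{-1}:\cdots:\ell_n(x)^{-1})$, and let $I(\mathcal{R}_L)\subset\mathbb{C}[y_0,\dots,y_n]$ be its vanishing ideal. Let $\omega\in\mathbb{Z}^{n+1}$ be a weight vector with pairwise distinct entries. For a polynomial $f$ let $\mathrm{in}_\omega(f)$ be the sum of the terms $c_\alpha y^\alpha$ of $f$ with $\omega\cdot\alpha$ maximal, and let $J=\mathrm{in}_\omega(I(\mathcal{R}_L))$ be the ideal spanned by all $\mathrm{in}_\omega(f)$, $f\in I(\mathcal{R}_L)$. Let $M(L)$ be the matroid on $\{0,\dots,n\}$ whose dependent sets index the linearly dependent columns of $L$.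 An $\omega$-broken circuit of $M(L)$ is a set obtained from a circuit of $M(L)$ by deleting its element of smallest $\omega$-weight. Let $M^\omega(L)$ be the independence system on $\{0,\dots,n\}$ whose circuits are the inclusion-minimal $\omega$-broken circuits of $M(L)$: its independent sets are the sets that contain no $\omega$-broken circuit, and its bases are the maximal independent sets. (It need not be a matroid; when there is a matroid on $\{0,\dots,n\}$ with these circuits, its bases are the bases of $M^\omega(L)$.) Then $\deg\mathcal{R}_L$ equals the number of bases of $M^\omega(L)$, and the minimal primes of $J$ are exactly the ideals $\langle y_i : i\in B^c\rangle$, where $B$ runs over all bases of $M^\omega(L)$ and $B^c=\{0,\dots,n\}\setminus B$. In particular, if a matroid on $\{0,\dots,n\}$ has as its circuits exactly the minimal $\omega$-broken circuits of $M(L)$, both statements hold with $B$ running over the bases of that matroid. -/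

import Mathlib

open scoped LinearAlgebra.Projectivization

noncomputable section

namespace ReciprocalLinear

/-! ### Projective varieties in `ℙⁿ`: vanishing ideal, Zariski closure, degree -/

/-- Complex projective space `ℙⁿ` with homogeneous coordinates `y₀, …, yₙ`. -/
abbrev PSpace (n : ℕ) : Type := ℙ ℂ (Fin (n + 1) → ℂ)

/-- The polynomial ring `ℂ[y₀, …, yₙ]`. -/
abbrev PolyRing (n : ℕ) : Type := MvPolynomial (Fin (n + 1)) ℂ

/-- A polynomial vanishes at a point of `ℙⁿ` if it vanishes on every choice of homogeneous
coordinates of that point (for homogeneous polynomials, one choice suffices). -/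
def VanishesAt {n : ℕ} (f : PolyRing n) (p : PSpace n) : Prop :=
  ∀ (v : Fin (n + 1) → ℂ) (hv : v ≠ 0), Projectivization.mk ℂ v hv = p →
    MvPolynomial.eval v f = 0

/-- The (homogeneous) vanishing ideal `I(S) ⊆ ℂ[y₀, …, yₙ]` of a subset of `ℙⁿ`. -/
def vanishingIdeal {n : ℕ} (S : Set (PSpace n)) : Ideal (PolyRing n) where
  carrier := {f | ∀ p ∈ S, VanishesAt f p}
  add_mem' {f g} hf hg p hp v hv h := by simp [hf p hp v hv h, hg p hp v hv h]
  zero_mem' _ _ _ _ _ := by simp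
  smul_mem' c f hf p hp v hv h := by simp [hf p hp v hv h]

/-- The Zariski closure of a subset of `ℙⁿ`. -/
def zariskiClosure {n : ℕ} (S : Set (PSpace n)) : Set (PSpace n) :=
  {p | ∀ f ∈ vanishingIdeal S, VanishesAt f p}

/-- The Hilbert function `q ↦ dim_ℂ (ℂ[y₀, …, yₙ]_q / I_q)` of an ideal `I`,
where `I_q` consists of the homogeneous polynomials of degree `q` in `I`. -/
def hilbertFunction {n : ℕ} (I : Ideal (PolyRing n)) (q : ℕ) : ℕ :=
  Module.finrank ℂ
    (MvPolynomial.homogeneousSubmodule (Fin (n + 1)) ℂ q ⧸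
      (I.restrictScalars ℂ).comap (MvPolynomial.homogeneousSubmodule (Fin (n + 1)) ℂ q).subtype)

/-- `HasDegree V δ`: the projective variety `V ⊆ ℙⁿ` has degree `δ`. That is, the Hilbert function
of `V` agrees for all large arguments with a polynomial `P` (the Hilbert polynomial, which is
unique and whose degree `r` is the dimension of `V` when `V` is nonempty), and `δ` is `r!` times
the leading coefficient of `P`. -/
def HasDegree {n : ℕ} (V : Set (PSpace n)) (δ : ℕ) : Prop :=
  ∃ P : Polynomial ℚ,
    (∀ᶠ q : ℕ in Filter.atTop, (hilbertFunction (vanishingIdeal V) q : ℚ) = P.eval (q : ℚ)) ∧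
    (δ : ℚ) = (P.natDegree.factorial : ℚ) * P.leadingCoeff

/-! ### The reciprocal linear space of a matrix -/

/-- The affine-linear functions: `ℓᵢ(x)` is the `i`-th entry of the row `(1, x₁, …, x_d) · L`. -/
def ell {d n : ℕ} (L : Matrix (Fin (d + 1)) (Fin (n + 1)) ℂ) (x : Fin d → ℂ) :
    Fin (n + 1) → ℂ :=
  Matrix.vecMul (Fin.cons 1 x : Fin (d + 1) → ℂ) L

/-- The complement `X ⊆ ℂᵈ` of the arrangement `{ℓ₀ ⋯ ℓₙ = 0}`. -/
def arrangementComplement {d n : ℕ} (L : Matrix (Fin (d + 1)) (Fin (n + 1)) ℂ) :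
    Set (Fin d → ℂ) :=
  {x | ∀ i, ell L x i ≠ 0}

/-- The map `φ : X → ℙⁿ`, `x ↦ (ℓ₀(x)⁻¹ : ⋯ : ℓₙ(x)⁻¹)`. -/
def phi {d n : ℕ} (L : Matrix (Fin (d + 1)) (Fin (n + 1)) ℂ) (x : arrangementComplement L) :
    PSpace n :=
  Projectivization.mk ℂ (fun i => (ell L x.1 i)⁻¹)
    (fun h => inv_ne_zero (x.2 0) (congrFun h 0))

/-- The reciprocal linear space `R_L`: the Zariski closure of the image of `φ` in `ℙⁿ`. -/
def reciprocalLinearSpace {d n : ℕ} (L : Matrix (Fin (d + 1)) (Fin (n + 1)) ℂ) :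
    Set (PSpace n) :=
  zariskiClosure (Set.range (phi L))

/-! ### Initial ideals with respect to a weight vector -/

/-- The initial form `in_ω(f)`: the sum of the terms `c_α y^α` of `f` for which the weight
`ω · α = ∑ i, α i * ω i` is maximal among the terms of `f`. -/
def initialForm {n : ℕ} (ω : Fin (n + 1) → ℤ) (f : PolyRing n) : PolyRing n :=
  ∑ α ∈ f.support with ∀ β ∈ f.support, Finsupp.weight ω β ≤ Finsupp.weight ω α,
    MvPolynomial.monomial α (f.coeff α)

/-- The initial ideal `in_ω(I)`. (The linear span of the initial forms of elements of `I` is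
already an ideal, because `y^β * in_ω(f) = in_ω(y^β * f)`.) -/
def initialIdeal {n : ℕ} (ω : Fin (n + 1) → ℤ) (I : Ideal (PolyRing n)) : Ideal (PolyRing n) :=
  Ideal.span {g | ∃ f ∈ I, g = initialForm ω f}

/-! ### The matroid of a matrix and its broken circuits -/

/-- The matroid `M(L)` on `{0, …, n}`: a set is independent if the columns of `L` that it indexes
are linearly independent. -/
def columnMatroid {d n : ℕ} (L : Matrix (Fin (d + 1)) (Fin (n + 1)) ℂ) :
    Matroid (Fin (n + 1)) :=
  (IndepMatroid.ofFinite (E := Set.univ) Set.finite_univ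
    (fun S => LinearIndepOn ℂ L.col S)
    (linearIndepOn_empty ℂ L.col)
    (fun _ _ hJ hIJ => hJ.mono hIJ)
    (by
      intro I J hI hJ hlt
      by_contra! hcon
      have hsub : L.col '' J ⊆ Submodule.span ℂ (L.col '' I) := by
        rintro _ ⟨e, he, rfl⟩
        by_contra hnot
        by_cases heI : e ∈ I
        · exact hnot (Submodule.subset_span ⟨e, heI, rfl⟩)
        · exact hcon e he heI (hI.insert hnot)
      have hle := Submodule.finrank_mono (Submodule.span_le.2 hsub)
      have key : ∀ S : Set (Fin (n + 1)), LinearIndepOn ℂ L.col S →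
          Module.finrank ℂ (Submodule.span ℂ (L.col '' S)) = S.ncard := by
        intro S hS
        have : Fintype S := Fintype.ofFinite S
        have h := finrank_span_eq_card (R := ℂ) hS.linearIndependent
        rw [← Nat.card_eq_fintype_card, Nat.card_coe_set_eq] at h
        rw [← h, Set.image_eq_range]
      rw [key I hI, key J hJ] at hle
      omega)
    (fun _ _ => Set.subset_univ _)).matroid

/-- `D` is an `ω`-broken circuit of `M(L)`: it is obtained from a circuit of `M(L)` by deleting
the element with the smallest `ω`-weight. -/
def IsBrokenCircuit {d n : ℕ} (L : Matrix (Fin (d + 1)) (Fin (n + 1)) ℂ) (ω : Fin (n + 1) → ℤ)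
    (D : Set (Fin (n + 1))) : Prop :=
  ∃ C, (columnMatroid L).IsCircuit C ∧ ∃ i ∈ C, (∀ j ∈ C, ω i ≤ ω j) ∧ D = C \ {i}

/-- `D` is an inclusion-minimal `ω`-broken circuit of `M(L)`. -/
def IsMinimalBrokenCircuit {d n : ℕ} (L : Matrix (Fin (d + 1)) (Fin (n + 1)) ℂ)
    (ω : Fin (n + 1) → ℤ) (D : Set (Fin (n + 1))) : Prop :=
  Minimal (IsBrokenCircuit L ω) D

/-- Independence in `M^ω(L)`, the independence system on `{0, …, n}` whose circuits (minimal
dependent sets) are the minimal `ω`-broken circuits of `M(L)`. -/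
def OmegaIndep {d n : ℕ} (L : Matrix (Fin (d + 1)) (Fin (n + 1)) ℂ) (ω : Fin (n + 1) → ℤ)
    (S : Set (Fin (n + 1))) : Prop :=
  ∀ D, IsMinimalBrokenCircuit L ω D → ¬ D ⊆ S

/-- The bases of `M^ω(L)`: its maximal independent sets. -/
def IsOmegaBase {d n : ℕ} (L : Matrix (Fin (d + 1)) (Fin (n + 1)) ℂ) (ω : Fin (n + 1) → ℤ)
    (B : Set (Fin (n + 1))) : Prop :=
  Maximal (OmegaIndep L ω) B

/-- The ideal `⟨yᵢ : i ∉ B⟩` of `ℂ[y₀, …, yₙ]`. -/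
def coordIdeal {n : ℕ} (B : Set (Fin (n + 1))) : Ideal (PolyRing n) :=
  Ideal.span (MvPolynomial.X '' Bᶜ)

end ReciprocalLinear

end

/-! The argument is a standard-monomial one; call a monomial standard if its support contains no
broken circuit.

Suppose `ℓ i = ∑ a j • ℓ j` with every `j` heavier than `i`. If the support of `α` contains all `j`
with `a j ≠ 0`, then `y^α - ∑ a j y^(α - e_j + e_i)` vanishes on `R_L`, and its initial form is
`y^α`. Repeated rewriting expresses each monomial modulo the ideal by standard monomials of the same
degree and no larger weight (`exists_normalForm`).

Conversely, standard monomials are linearly independent as functions of the `(ℓ i)⁻¹`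
(`coeff_eq_zero_of_sum_reciprocal_eq_zero`). Take the heaviest `e` and the terms with the highest
pole along `ℓ e = 0`: they give a relation between the forms restricted to that hyperplane, where
the supports without `e` still contain no broken circuit, and induction applies.

So standard monomials form a basis of the coordinate ring in each degree, and the initial ideal is
the Stanley–Reisner ideal of the broken circuit complex, whose facets are the bases of `M^ω(L)`. The
minimal primes are then the coordinate primes of the facets. The Hilbert function at large `q` is `∑
C(q - 1, |F| - 1)` over nonempty faces `F`; the largest faces have size the rank of `L`, and they
are exactly the facets (`isOmegaBase_iff`), so the degree counts them. -/

namespace ReciprocalLinear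

open Module Filter Topology

/-! ### Sets without broken circuits, in terms of spans -/

section NoBrokenCircuit

variable {ι V : Type*} [AddCommGroup V] [Module ℂ V]

/-- `S` contains no broken circuit of the vector configuration `w` restricted to `E`: no `w i` with
`i ∈ E` is a linear combination of those `w j`, `j ∈ S`, for which `j` has larger weight. -/
def NoBrokenCircuit (w : ι → V) (ω : ι → ℤ) (E S : Set ι) : Prop :=
  ∀ i ∈ E, w i ∉ Submodule.span ℂ (w '' {j | j ∈ S ∧ ω i < ω j})

lemma NoBrokenCircuit.mono {w : ι → V} {ω : ι → ℤ} {E E' S S' : Set ι}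
    (h : NoBrokenCircuit w ω E S) (hE : E' ⊆ E) (hS : S' ⊆ S) : NoBrokenCircuit w ω E' S' :=
  fun i hi hmem => h i (hE hi) <|
    Submodule.span_mono (Set.image_mono (Set.inter_subset_inter_left _ hS)) hmem

lemma NoBrokenCircuit.ne_zero {w : ι → V} {ω : ι → ℤ} {E S : Set ι}
    (h : NoBrokenCircuit w ω E S) {i : ι} (hi : i ∈ E) : w i ≠ 0 := fun h0 =>
  h i hi (h0 ▸ Submodule.zero_mem _)

lemma noBrokenCircuit_map {W : Type*} [AddCommGroup W] [Module ℂ W] (f : V →ₗ[ℂ] W)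
    (hf : Function.Injective f) (w : ι → V) (ω : ι → ℤ) (E S : Set ι) :
    NoBrokenCircuit (fun i => f (w i)) ω E S ↔ NoBrokenCircuit w ω E S := by
  refine forall₂_congr fun i _ => not_congr ?_
  rw [show (fun i => f (w i)) '' {j | j ∈ S ∧ ω i < ω j} = f '' (w '' {j | j ∈ S ∧ ω i < ω j}) by
    rw [Set.image_image], Submodule.span_image]
  exact hf.mem_set_image (s := (Submodule.span ℂ (w '' {j | j ∈ S ∧ ω i < ω j}) : Set V))

end NoBrokenCircuit

/-! ### Linear independence of reciprocal monomials without broken circuits -/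

section Independence

variable {ι : Type*} {V : Type} [AddCommGroup V] [Module ℂ V]

/-- A functional vanishing on `ker (ℓ e)` is a multiple of `ℓ e`, so a relation on the hyperplane
lifts to `V` once `ℓ e` is allowed in it. -/
lemma mem_span_of_restrict_mem_span (ℓ : ι → Dual ℂ V) (e i : ι) (T : Set ι)
    (h : (ℓ i).domRestrict (LinearMap.ker (ℓ e)) ∈
      Submodule.span ℂ ((fun j => (ℓ j).domRestrict (LinearMap.ker (ℓ e))) '' T)) :
    ℓ i ∈ Submodule.span ℂ (ℓ '' insert e T) := by
  have h1 : (fun j => (ℓ j).domRestrict (LinearMap.ker (ℓ e))) '' T =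
      (LinearMap.ker (ℓ e)).dualRestrict '' (ℓ '' T) := by
    rw [Set.image_image]; rfl
  rw [h1, Submodule.span_image] at h
  obtain ⟨g, hg, hgi⟩ := h
  have hker : ⨅ _ : Unit, LinearMap.ker (ℓ e) ≤ LinearMap.ker (ℓ i - g) := by
    intro v hv
    have := LinearMap.congr_fun hgi ⟨v, by simpa using hv⟩
    simp only [Submodule.dualRestrict_apply, LinearMap.domRestrict_apply] at this
    simp [this]
  have hmem := mem_span_of_iInf_ker_le_ker (L := fun _ : Unit => ℓ e) hker
  rw [Set.image_insert_eq, ← sub_add_cancel (ℓ i) g]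
  refine add_mem (Submodule.span_mono ?_ hmem) (Submodule.span_mono (Set.subset_insert _ _) hg)
  rintro _ ⟨_, rfl⟩
  exact Set.mem_insert _ _

/-- Since `e` outweighs every `i ∈ E`, it is admissible in the span test for `i`; a relation on the
hyperplane therefore lifts to a forbidden relation on `V`. -/
lemma NoBrokenCircuit.contract {ℓ : ι → Dual ℂ V} {ω : ι → ℤ} {E S : Set ι} {e : ι}
    (he : ∀ i ∈ E, ω i < ω e) (h : NoBrokenCircuit ℓ ω (insert e E) (insert e S)) :
    NoBrokenCircuit (fun j => (ℓ j).domRestrict (LinearMap.ker (ℓ e))) ω E S := by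
  intro i hi hmem
  refine h i (Set.mem_insert_of_mem _ hi)
    (Submodule.span_mono (Set.image_mono ?_) (mem_span_of_restrict_mem_span ℓ e i _ hmem))
  rintro j (rfl | hj)
  · exact ⟨Set.mem_insert _ _, he i hi⟩
  · exact ⟨Set.mem_insert_of_mem _ hj.1, hj.2⟩

lemma eventually_line_ne_zero (ℓ : ι → Dual ℂ V) (E : Finset ι) (v u : V)
    (hv : ∀ i ∈ E, ℓ i v ≠ 0) : ∀ᶠ t : ℂ in 𝓝 0, ∀ i ∈ E, ℓ i (v + t • u) ≠ 0 := by
  rw [Finset.eventually_all]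
  intro i hi
  have hc : ContinuousAt (fun t : ℂ => ℓ i (v + t • u)) 0 := by
    simp only [map_add, map_smul, smul_eq_mul]
    fun_prop
  exact hc.eventually_ne (by simpa using hv i hi)

lemma continuousAt_line (ℓ : ι → Dual ℂ V) (E : Finset ι) (A : Finset (ι →₀ ℕ))
    (c : (ι →₀ ℕ) → ℂ) (k : (ι →₀ ℕ) → ℕ) (v u : V) (hv : ∀ i ∈ E, ℓ i v ≠ 0) :
    ContinuousAt (fun t : ℂ =>
      ∑ α ∈ A, c α * (t ^ k α * ∏ i ∈ E, (ℓ i (v + t • u))⁻¹ ^ α i)) 0 := by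
  refine tendsto_finsetSum _ fun α _ => ?_
  refine (continuousAt_const (y := c α)).mul (ContinuousAt.mul (by fun_prop) ?_)
  refine tendsto_finsetProd _ fun i hi => ?_
  have hc : ContinuousAt (fun t : ℂ => ℓ i (v + t • u)) 0 := by
    simp only [map_add, map_smul, smul_eq_mul]
    fun_prop
  exact (hc.inv₀ (by simpa using hv i hi)).pow _

lemma eq_zero_of_continuousAt {F : ℂ → ℂ} (hF : ContinuousAt F 0)
    (h : ∀ᶠ t in 𝓝[≠] 0, F t = 0) : F 0 = 0 :=
  tendsto_nhds_unique_of_eventuallyEq (hF.tendsto.mono_left nhdsWithin_le_nhds)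
    tendsto_const_nhds h

/-- A relation between reciprocal monomials extends over the hyperplane `h = 0`. -/
lemma sum_eq_zero_of_forall_ne_zero (ℓ : ι → Dual ℂ V) (h : Dual ℂ V) (hh : h ≠ 0)
    (E : Finset ι) (A : Finset (ι →₀ ℕ)) (c : (ι →₀ ℕ) → ℂ)
    (H : ∀ v, (∀ i ∈ E, ℓ i v ≠ 0) → h v ≠ 0 →
      ∑ α ∈ A, c α * ∏ i ∈ E, (ℓ i v)⁻¹ ^ α i = 0)
    (v : V) (hv : ∀ i ∈ E, ℓ i v ≠ 0) :
    ∑ α ∈ A, c α * ∏ i ∈ E, (ℓ i v)⁻¹ ^ α i = 0 := by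
  by_cases h0 : h v = 0
  · obtain ⟨u, hu⟩ : ∃ u, h u ≠ 0 := by
      by_contra! hcon
      exact hh (LinearMap.ext hcon)
    -- The line `v + t • u` leaves the hyperplane as soon as `t ≠ 0`; the exponent `k = 0` switches
    -- off the factor `t ^ k α`.
    have := eq_zero_of_continuousAt (continuousAt_line ℓ E A c 0 v u hv) (by
      filter_upwards [nhdsWithin_le_nhds (eventually_line_ne_zero ℓ E v u hv),
        self_mem_nhdsWithin] with t ht ht0
      simpa using H _ ht (by simpa [h0, hu] using ht0))
    simpa using this
  · exact H v hv h0

/-- The leading part, with respect to the pole along `ℓ e`, of a relation between reciprocal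
monomials is a relation on the hyperplane `ℓ e = 0`. -/
lemma sum_leading_eq_zero [DecidableEq ι] (ℓ : ι → Dual ℂ V) {e : ι} (he : ℓ e ≠ 0)
    {E : Finset ι} (heE : e ∉ E) (A : Finset (ι →₀ ℕ)) (c : (ι →₀ ℕ) → ℂ) (m : ℕ)
    (hm : ∀ α ∈ A, α e ≤ m)
    (H : ∀ v, (∀ i ∈ insert e E, ℓ i v ≠ 0) →
      ∑ α ∈ A, c α * ∏ i ∈ insert e E, (ℓ i v)⁻¹ ^ α i = 0)
    (v : V) (hve : ℓ e v = 0) (hv : ∀ i ∈ E, ℓ i v ≠ 0) :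
    ∑ α ∈ A with α e = m, c α * ∏ i ∈ E, (ℓ i v)⁻¹ ^ α i = 0 := by
  obtain ⟨u, hu⟩ : ∃ u, ℓ e u = 1 := by
    obtain ⟨u, hu⟩ : ∃ u, ℓ e u ≠ 0 := by
      by_contra! hcon
      exact he (LinearMap.ext hcon)
    exact ⟨(ℓ e u)⁻¹ • u, by simp [hu]⟩
  -- On this line `ℓ e` equals `t`, so multiplying by `t ^ m` clears the poles and leaves `t ^ (m -
  -- α e)`; at `t = 0` only the terms with `α e = m` survive.
  have := eq_zero_of_continuousAt (continuousAt_line ℓ E A c (fun α => m - α e) v u hv) (by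
    filter_upwards [nhdsWithin_le_nhds (eventually_line_ne_zero ℓ E v u hv),
      self_mem_nhdsWithin] with t ht ht0
    have ht0 : t ≠ 0 := ht0
    have het : ℓ e (v + t • u) = t := by simp [hve, hu]
    have h1 := H (v + t • u) (by
      intro i hi
      rcases Finset.mem_insert.1 hi with rfl | hi
      · rwa [het]
      · exact ht i hi)
    rw [← mul_zero (t ^ m), ← h1, Finset.mul_sum]
    refine Finset.sum_congr rfl fun α hα => ?_
    rw [Finset.prod_insert heE, het, pow_sub₀ _ ht0 (hm α hα), inv_pow]
    ring)
  refine Eq.trans ?_ this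
  rw [Finset.sum_filter]
  refine Finset.sum_congr rfl fun α hα => ?_
  have hle := hm α hα
  split_ifs with h
  · simp [h]
  · rw [zero_pow (by omega)]; simp

/-- Reciprocal monomials whose supports contain no broken circuit are linearly independent. -/
theorem coeff_eq_zero_of_sum_reciprocal_eq_zero [DecidableEq ι] (ω : ι → ℤ)
    (hω : Function.Injective ω) (E : Finset ι) :
    ∀ {V : Type} [AddCommGroup V] [Module ℂ V] (ℓ : ι → Dual ℂ V) (A : Finset (ι →₀ ℕ))
      (c : (ι →₀ ℕ) → ℂ),
      (∀ α ∈ A, NoBrokenCircuit ℓ ω E {i | i ∈ E ∧ α i ≠ 0}) →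
      (∀ α ∈ A, ∀ β ∈ A, (∀ i ∈ E, α i = β i) → α = β) →
      (∀ v, (∀ i ∈ E, ℓ i v ≠ 0) → ∑ α ∈ A, c α * ∏ i ∈ E, (ℓ i v)⁻¹ ^ α i = 0) →
      ∀ α ∈ A, c α = 0 := by
  -- The heaviest element is split off; `V` and `ℓ` must vary because one case passes to `ker (ℓ
  -- e)`.
  induction E using Finset.induction_on_max_value ω with
  | empty =>
    intro V _ _ ℓ A c _ hinj H α hα
    have hA : A = {α} :=
      Finset.eq_singleton_iff_unique_mem.2 ⟨hα, fun β hβ => hinj β hβ α hα (by simp)⟩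
    simpa [hA] using H 0 (by simp)
  | insert e E heE hmax ih =>
    intro V _ _ ℓ A c hA hinj H
    by_contra! hcon
    obtain ⟨α₁, hα₁, hcα₁⟩ := hcon
    have hlt : ∀ i ∈ E, ω i < ω e := fun i hi =>
      lt_of_le_of_ne (hmax i hi) fun h => heE (hω h ▸ hi)
    have he : ℓ e ≠ 0 := (hA α₁ hα₁).ne_zero (by simp)
    obtain ⟨α₀, hα₀, hmaxα₀⟩ := Finset.exists_max_image (A.filter (c · ≠ 0)) (· e)
      ⟨α₁, by simp [hα₁, hcα₁]⟩
    have hsub : ∀ α ∈ A.filter (c · ≠ 0), α ∈ A := fun α hα => (Finset.mem_filter.1 hα).1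
    have H' : ∀ v, (∀ i ∈ insert e E, ℓ i v ≠ 0) →
        ∑ α ∈ A.filter (c · ≠ 0), c α * ∏ i ∈ insert e E, (ℓ i v)⁻¹ ^ α i = 0 := by
      intro v hv
      refine Eq.trans ?_ (H v hv)
      refine Finset.sum_subset (Finset.filter_subset _ _) fun α hα hα' => ?_
      have : c α = 0 := by simpa [hα] using hα'
      rw [this, zero_mul]
    refine (Finset.mem_filter.1 hα₀).2 ?_
    rcases Nat.eq_zero_or_pos (α₀ e) with h0 | hpos
    -- No surviving term has a pole along `ℓ e`, so `e` can be dropped once the relation is extended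
    -- over `ℓ e = 0`.
    · have hz : ∀ α ∈ A.filter (c · ≠ 0), α e = 0 := fun α hα => by
        have := hmaxα₀ α hα
        omega
      refine ih ℓ (A.filter (c · ≠ 0)) c (fun α hα => (hA α (hsub α hα)).mono (by simp) ?_) ?_ ?_
        α₀ hα₀
      · rintro i ⟨hi, hi'⟩
        exact ⟨Finset.mem_insert_of_mem hi, hi'⟩
      · intro α hα β hβ hαβ
        refine hinj α (hsub α hα) β (hsub β hβ) fun i hi => ?_
        rcases Finset.mem_insert.1 hi with rfl | hi
        · rw [hz α hα, hz β hβ]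
        · exact hαβ i hi
      · refine sum_eq_zero_of_forall_ne_zero ℓ (ℓ e) he E _ c fun v hv hev => ?_
        refine Eq.trans ?_ (H' v (by simpa [hev] using hv))
        refine Finset.sum_congr rfl fun α hα => ?_
        rw [Finset.prod_insert heE, hz α hα, pow_zero, one_mul]
    -- The terms of maximal pole order are restricted to the hyperplane. They share the exponent at
    -- `e`, so they stay distinct on `E`.
    · refine ih (fun j => (ℓ j).domRestrict (LinearMap.ker (ℓ e)))
        ((A.filter (c · ≠ 0)).filter (· e = α₀ e)) c ?_ ?_ ?_ α₀ (by simpa using hα₀)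
      · intro α hα
        obtain ⟨hα, hαe⟩ := Finset.mem_filter.1 hα
        refine NoBrokenCircuit.contract hlt ((hA α (hsub α hα)).mono (by simp) ?_)
        rintro i (rfl | hi)
        · exact ⟨Finset.mem_insert_self _ _, by omega⟩
        · exact ⟨Finset.mem_insert_of_mem hi.1, hi.2⟩
      · intro α hα β hβ hαβ
        obtain ⟨hα, hαe⟩ := Finset.mem_filter.1 hα
        obtain ⟨hβ, hβe⟩ := Finset.mem_filter.1 hβ
        refine hinj α (hsub α hα) β (hsub β hβ) fun i hi => ?_
        rcases Finset.mem_insert.1 hi with rfl | hi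
        · rw [hαe, hβe]
        · exact hαβ i hi
      · rintro ⟨v, hve⟩ hv
        exact sum_leading_eq_zero ℓ he heE _ c (α₀ e) hmaxα₀ H' v hve hv

end Independence

end ReciprocalLinear

namespace ReciprocalLinear

open Module

/-! ### The independence system `M^ω(L)` -/

section OmegaSystem

variable {d n : ℕ} {L : Matrix (Fin (d + 1)) (Fin (n + 1)) ℂ} {ω : Fin (n + 1) → ℤ}

lemma omegaIndep_iff_forall_isBrokenCircuit (S : Set (Fin (n + 1))) :
    OmegaIndep L ω S ↔ ∀ D, IsBrokenCircuit L ω D → ¬ D ⊆ S := by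
  refine ⟨fun h D hD hDS => ?_, fun h D hD => h D hD.prop⟩
  obtain ⟨D', hD', hmin⟩ :=
    (Set.toFinite {D | IsBrokenCircuit L ω D}).exists_le_minimal (a := D) hD
  exact h D' hmin (hD'.trans hDS)

lemma NoBrokenCircuit.not_subset (hω : Function.Injective ω) {S : Set (Fin (n + 1))}
    (h : NoBrokenCircuit L.col ω Set.univ S) {D : Set (Fin (n + 1))}
    (hD : IsBrokenCircuit L ω D) : ¬ D ⊆ S := by
  obtain ⟨C, hC, i, hi, hmin, rfl⟩ := hD
  intro hsub
  refine h i (Set.mem_univ _) ?_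
  have hind : LinearIndepOn ℂ L.col (C \ {i}) := hC.sdiff_singleton_indep hi
  have hmem : L.col i ∈ Submodule.span ℂ (L.col '' (C \ {i})) := by
    by_contra hnot
    refine hC.not_indep ?_
    have := hind.insert hnot
    rwa [Set.insert_sdiff_singleton, Set.insert_eq_of_mem hi] at this
  refine Submodule.span_mono (Set.image_mono ?_) hmem
  intro j hj
  refine ⟨hsub hj, ?_⟩
  exact lt_of_le_of_ne (hmin j hj.1) fun he => hj.2 (hω he.symm)

lemma exists_isBrokenCircuit_subset_of_not_linearIndepOn {S : Set (Fin (n + 1))}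
    (h : ¬ LinearIndepOn ℂ L.col S) :
    ∃ C ⊆ S, ∃ i ∈ C, (∀ j ∈ C, ω i ≤ ω j) ∧ IsBrokenCircuit L ω (C \ {i}) := by
  have hdep : (columnMatroid L).Dep S := ⟨h, Set.subset_univ _⟩
  obtain ⟨C, hCS, hC⟩ := hdep.exists_isCircuit_subset
  obtain ⟨i, hi, hmin⟩ := Set.exists_min_image C ω (Set.toFinite C) hC.nonempty
  exact ⟨C, hCS, i, hi, hmin, C, hC, i, hi, hmin, rfl⟩

/-- Independence in `M^ω(L)` in terms of spans of columns. -/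
lemma omegaIndep_iff (hω : Function.Injective ω) (S : Set (Fin (n + 1))) :
    OmegaIndep L ω S ↔ NoBrokenCircuit L.col ω Set.univ S := by
  rw [omegaIndep_iff_forall_isBrokenCircuit]
  refine ⟨fun h i _ hmem => ?_, fun h D hD => h.not_subset hω hD⟩
  have hdep : ¬ LinearIndepOn ℂ L.col (insert i {j | j ∈ S ∧ ω i < ω j}) := by
    rw [linearIndepOn_insert (by simp)]
    exact fun h => h.2 hmem
  obtain ⟨C, hCS, k, hk, hmin, hbc⟩ := exists_isBrokenCircuit_subset_of_not_linearIndepOn hdep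
  -- If `i ∈ C`, then `i` is the lightest element and deleting it leaves a subset of `S`; otherwise
  -- `C` already lies in `S`.
  refine h _ hbc ?_
  rintro j ⟨hj, hjk⟩
  rcases hCS hj with rfl | hjS
  · rcases hCS hk with rfl | hkS
    · exact absurd rfl hjk
    · exact absurd (hmin _ hj) (not_le.2 hkS.2)
  · exact hjS.1

lemma NoBrokenCircuit.linearIndepOn (hω : Function.Injective ω) {S : Set (Fin (n + 1))}
    (h : NoBrokenCircuit L.col ω Set.univ S) : LinearIndepOn ℂ L.col S := by
  by_contra hcon
  obtain ⟨C, hCS, k, -, -, hbc⟩ :=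
    exists_isBrokenCircuit_subset_of_not_linearIndepOn (ω := ω) hcon
  exact h.not_subset hω hbc (Set.sdiff_subset.trans hCS)

/-- A set without broken circuits whose columns do not span can be enlarged. -/
lemma NoBrokenCircuit.exists_insert {S : Set (Fin (n + 1))}
    (h : NoBrokenCircuit L.col ω Set.univ S)
    (hS : ∃ i, L.col i ∉ Submodule.span ℂ (L.col '' S)) :
    ∃ i ∉ S, NoBrokenCircuit L.col ω Set.univ (insert i S) := by
  obtain ⟨i, hi, hmin⟩ := Set.exists_min_image
    {i | L.col i ∉ Submodule.span ℂ (L.col '' S)} ω (Set.toFinite _) hS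
  refine ⟨i, fun hiS => hi (Submodule.subset_span ⟨i, hiS, rfl⟩), fun k hk hmem => ?_⟩
  rcases lt_or_ge (ω k) (ω i) with hlt | hle
  -- By minimality of `i`, any lighter column lies in the span of `S`; a new relation for `k` would,
  -- by exchange, put column `i` there too.
  · have hkS : L.col k ∈ Submodule.span ℂ (L.col '' S) := by
      by_contra hcon
      exact absurd (hmin k hcon) (not_le.2 hlt)
    have h1 : L.col k ∈
        Submodule.span ℂ (insert (L.col i) (L.col '' {j | j ∈ S ∧ ω k < ω j})) := by
      rw [← Set.image_insert_eq]
      refine Submodule.span_mono (Set.image_mono ?_) hmem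
      rintro j ⟨rfl | hj, hj'⟩
      · exact Set.mem_insert _ _
      · exact Set.mem_insert_of_mem _ ⟨hj, hj'⟩
    have h2 := mem_span_insert_exchange h1 (h k hk)
    refine hi (Submodule.span_le.2 ?_ h2)
    rintro _ (rfl | ⟨j, hj, rfl⟩)
    · exact hkS
    · exact Submodule.subset_span ⟨j, hj.1, rfl⟩
  · refine h k hk (Submodule.span_mono (Set.image_mono ?_) hmem)
    rintro j ⟨rfl | hj, hj'⟩
    · exact absurd hj' (not_lt.2 hle)
    · exact ⟨hj, hj'⟩

lemma finrank_span_image_eq_ncard {S : Set (Fin (n + 1))} (hS : LinearIndepOn ℂ L.col S) :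
    finrank ℂ (Submodule.span ℂ (L.col '' S)) = S.ncard := by
  have : Fintype S := Fintype.ofFinite S
  have h := finrank_span_eq_card (R := ℂ) hS.linearIndependent
  rw [← Nat.card_eq_fintype_card, Nat.card_coe_set_eq] at h
  rw [← h, Set.image_eq_range]

lemma NoBrokenCircuit.ncard_le (hω : Function.Injective ω) {S : Set (Fin (n + 1))}
    (h : NoBrokenCircuit L.col ω Set.univ S) :
    S.ncard ≤ finrank ℂ (Submodule.span ℂ (Set.range L.col)) := by
  rw [← finrank_span_image_eq_ncard (h.linearIndepOn hω)]
  exact Submodule.finrank_mono (Submodule.span_mono (Set.image_subset_range _ _))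

/-- All bases of `M^ω(L)` have cardinality the rank of `L`. -/
lemma isOmegaBase_iff (hω : Function.Injective ω) (B : Set (Fin (n + 1))) :
    IsOmegaBase L ω B ↔ NoBrokenCircuit L.col ω Set.univ B ∧
      B.ncard = finrank ℂ (Submodule.span ℂ (Set.range L.col)) := by
  constructor
  · intro hB
    have hB' := (omegaIndep_iff hω B).1 hB.prop
    refine ⟨hB', ?_⟩
    rw [← finrank_span_image_eq_ncard (hB'.linearIndepOn hω)]
    suffices hspan : Submodule.span ℂ (L.col '' B) = Submodule.span ℂ (Set.range L.col) by
      rw [hspan]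
    refine le_antisymm (Submodule.span_mono (Set.image_subset_range _ _)) (Submodule.span_le.2 ?_)
    rintro _ ⟨i, rfl⟩
    by_contra hi
    obtain ⟨k, hk, hins⟩ := hB'.exists_insert ⟨i, hi⟩
    exact hk (hB.le_of_ge ((omegaIndep_iff hω _).2 hins) (Set.subset_insert k B)
      (Set.mem_insert k B))
  · rintro ⟨hB, hcard⟩
    refine ⟨(omegaIndep_iff hω B).2 hB, fun S hS hBS => ?_⟩
    have := ((omegaIndep_iff hω S).1 hS).ncard_le hω
    exact (Set.eq_of_subset_of_ncard_le hBS (by omega) (Set.toFinite S)).ge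

lemma OmegaIndep.exists_isOmegaBase {S : Set (Fin (n + 1))} (h : OmegaIndep L ω S) :
    ∃ B, S ⊆ B ∧ IsOmegaBase L ω B :=
  (Set.toFinite {S | OmegaIndep L ω S}).exists_le_maximal h

lemma omegaIndep_empty (hL : ∀ i, L.col i ≠ 0) (hω : Function.Injective ω) :
    OmegaIndep L ω ∅ := by
  rw [omegaIndep_iff hω]
  intro i _
  simpa using hL i

/-- The bases of a matroid whose circuits are the minimal broken circuits. -/
lemma isBase_iff_isOmegaBase {M : Matroid (Fin (n + 1))} (hE : M.E = Set.univ)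
    (hM : ∀ D, M.IsCircuit D ↔ IsMinimalBrokenCircuit L ω D) (B : Set (Fin (n + 1))) :
    M.IsBase B ↔ IsOmegaBase L ω B := by
  have hind : M.Indep = OmegaIndep L ω := by
    funext S
    rw [Matroid.indep_iff_forall_subset_not_isCircuit (by simp [hE]), eq_iff_iff]
    simp only [OmegaIndep, hM]
    exact ⟨fun h D hD hDS => h D hDS hD, fun h D hDS hD => h D hD hDS⟩
  rw [Matroid.isBase_iff_maximal_indep, hind, IsOmegaBase]

end OmegaSystem

end ReciprocalLinear

namespace ReciprocalLinear

open Module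

/-! ### The vanishing ideal of the reciprocal linear space -/

section VanishingIdeal

variable {d n : ℕ}

lemma vanishingIdeal_zariskiClosure (S : Set (PSpace n)) :
    vanishingIdeal (zariskiClosure S) = vanishingIdeal S := by
  ext f
  refine ⟨fun hf p hp => hf p fun g hg => hg p hp, fun hf p hp => hp f hf⟩

/-- The linear form on `ℂ^(d+1)` whose coefficients are the `i`-th column of `L`. -/
def colForm (L : Matrix (Fin (d + 1)) (Fin (n + 1)) ℂ) (i : Fin (n + 1)) :
    Dual ℂ (Fin (d + 1) → ℂ) :=
  dotProductEquiv ℂ (Fin (d + 1)) (L.col i)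

variable {L : Matrix (Fin (d + 1)) (Fin (n + 1)) ℂ}

lemma colForm_apply (i : Fin (n + 1)) (z : Fin (d + 1) → ℂ) :
    colForm L i z = L.col i ⬝ᵥ z := rfl

lemma ell_eq_colForm (x : Fin d → ℂ) (i : Fin (n + 1)) :
    ell L x i = colForm L i (Fin.cons 1 x) := by
  rw [colForm_apply, dotProduct_comm]
  rfl

lemma noBrokenCircuit_colForm (ω : Fin (n + 1) → ℤ) (E S : Set (Fin (n + 1))) :
    NoBrokenCircuit (colForm L) ω E S ↔ NoBrokenCircuit L.col ω E S :=
  noBrokenCircuit_map (dotProductEquiv ℂ (Fin (d + 1))).toLinearMap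
    (dotProductEquiv ℂ (Fin (d + 1))).injective L.col ω E S

lemma eval_reciprocal (f : PolyRing n) (z : Fin (d + 1) → ℂ) :
    MvPolynomial.eval (fun i => (colForm L i z)⁻¹) f =
      ∑ α ∈ f.support, f.coeff α * ∏ i, (colForm L i z)⁻¹ ^ α i :=
  MvPolynomial.eval_eq' _ _

/-- Dividing `z` by `z 0` lands in the affine chart and only rescales the reciprocals, so the
projective point is a value of `phi`. -/
lemma eval_eq_zero_of_mem_of_ne_zero {f : PolyRing n}
    (hf : f ∈ vanishingIdeal (Set.range (phi L))) (z : Fin (d + 1) → ℂ)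
    (hz : ∀ i, colForm L i z ≠ 0) (hz0 : z 0 ≠ 0) :
    MvPolynomial.eval (fun i => (colForm L i z)⁻¹) f = 0 := by
  set x : Fin d → ℂ := fun k => (z 0)⁻¹ * z k.succ with hx
  have hcons : (Fin.cons 1 x : Fin (d + 1) → ℂ) = (z 0)⁻¹ • z := by
    funext k
    refine Fin.cases ?_ (fun k => ?_) k
    · simp [hz0]
    · simp [hx]
  have hell : ∀ i, ell L x i = (z 0)⁻¹ * colForm L i z := fun i => by
    rw [ell_eq_colForm, hcons, map_smul, smul_eq_mul]
  have hxX : x ∈ arrangementComplement L := fun i => by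
    rw [hell]
    exact mul_ne_zero (inv_ne_zero hz0) (hz i)
  refine hf _ ⟨⟨x, hxX⟩, rfl⟩ _ (fun h => inv_ne_zero (hz 0) (congrFun h 0)) ?_
  rw [phi, Projectivization.mk_eq_mk_iff']
  refine ⟨(z 0)⁻¹, ?_⟩
  funext i
  simp only [Pi.smul_apply, smul_eq_mul, hell]
  field_simp

lemma mem_vanishingIdeal_iff (f : PolyRing n) :
    f ∈ vanishingIdeal (reciprocalLinearSpace L) ↔ ∀ z, (∀ i, colForm L i z ≠ 0) →
      MvPolynomial.eval (fun i => (colForm L i z)⁻¹) f = 0 := by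
  rw [reciprocalLinearSpace, vanishingIdeal_zariskiClosure]
  constructor
  · intro hf z hz
    rw [eval_reciprocal]
    -- Points with `z 0 = 0` are outside the affine chart and are reached by continuity.
    refine sum_eq_zero_of_forall_ne_zero (colForm L) (LinearMap.proj 0) ?_ Finset.univ _ _ ?_ z
      (fun i _ => hz i)
    · intro h
      simpa using LinearMap.congr_fun h (fun _ => 1)
    · intro v hv hv0
      rw [← eval_reciprocal]
      exact eval_eq_zero_of_mem_of_ne_zero hf v (fun i => hv i (Finset.mem_univ i)) hv0
  · rintro hf _ ⟨x, rfl⟩ v hv hvx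
    rw [phi, Projectivization.mk_eq_mk_iff'] at hvx
    obtain ⟨a, ha⟩ := hvx
    have ha0 : a ≠ 0 := by
      rintro rfl
      exact hv (by rw [← ha, zero_smul])
    have hform : ∀ i, colForm L i (a⁻¹ • (Fin.cons 1 x.1 : Fin (d + 1) → ℂ)) =
        a⁻¹ * ell L x.1 i := fun i => by
      rw [ell_eq_colForm, map_smul, smul_eq_mul]
    have h := hf (a⁻¹ • (Fin.cons 1 x.1 : Fin (d + 1) → ℂ)) fun i => by
      rw [hform]
      exact mul_ne_zero (inv_ne_zero ha0) (x.2 i)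
    convert h using 2
    rw [← ha]
    congr 1
    funext i
    simp [hform, mul_comm]

/-- A polynomial in the vanishing ideal all of whose monomials have supports without broken
circuits is zero. -/
lemma eq_zero_of_mem_vanishingIdeal {ω : Fin (n + 1) → ℤ} (hω : Function.Injective ω)
    {f : PolyRing n} (hf : f ∈ vanishingIdeal (reciprocalLinearSpace L))
    (h : ∀ α ∈ f.support, NoBrokenCircuit L.col ω Set.univ (α.support : Set (Fin (n + 1)))) :
    f = 0 := by
  rw [mem_vanishingIdeal_iff] at hf
  by_contra hne
  obtain ⟨α, hα⟩ := MvPolynomial.support_nonempty.2 hne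
  refine MvPolynomial.mem_support_iff.1 hα
    (coeff_eq_zero_of_sum_reciprocal_eq_zero ω hω Finset.univ (colForm L) f.support
      (fun α => f.coeff α) ?_ ?_ ?_ α hα)
  · intro β hβ
    rw [noBrokenCircuit_colForm]
    exact (h β hβ).mono (by simp) fun i hi => by simpa using hi.2
  · intro β _ γ _ hβγ
    exact Finsupp.ext fun i => hβγ i (Finset.mem_univ i)
  · intro v hv
    rw [← eval_reciprocal]
    exact hf v fun i => hv i (Finset.mem_univ i)

/-- The straightening relation obtained from a linear relation between the columns. -/
lemma monomial_sub_sum_mem_vanishingIdeal {i : Fin (n + 1)} {a : Fin (n + 1) →₀ ℂ}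
    (ha : Finsupp.linearCombination ℂ L.col a = L.col i) {α : Fin (n + 1) →₀ ℕ}
    (hα : a.support ⊆ α.support) :
    MvPolynomial.monomial α 1 - ∑ j ∈ a.support,
        a j • MvPolynomial.monomial (α - Finsupp.single j 1 + Finsupp.single i 1) (1 : ℂ) ∈
      vanishingIdeal (reciprocalLinearSpace L) := by
  rw [mem_vanishingIdeal_iff]
  intro z hz
  set y : Fin (n + 1) → ℂ := fun i => (colForm L i z)⁻¹ with hy
  -- Trading a factor `y_j` for `y_i` multiplies the value by `ℓ j / ℓ i`, and `∑ a j * ℓ j = ℓ i`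
  -- makes these factors add up to 1.
  have hterm : ∀ j ∈ a.support, MvPolynomial.eval y
      (MvPolynomial.monomial (α - Finsupp.single j 1 + Finsupp.single i 1) (1 : ℂ)) =
        MvPolynomial.eval y (MvPolynomial.monomial α 1) * (colForm L j z * (colForm L i z)⁻¹) := by
    intro j hj
    have hle : Finsupp.single j 1 ≤ α := by
      rw [Finsupp.single_le_iff]
      exact Nat.one_le_iff_ne_zero.2 (Finsupp.mem_support_iff.1 (hα hj))
    conv_rhs => rw [← tsub_add_cancel_of_le hle]
    have hX : ∀ (γ : Fin (n + 1) →₀ ℕ) (k : Fin (n + 1)), MvPolynomial.eval y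
        (MvPolynomial.monomial (γ + Finsupp.single k 1) (1 : ℂ)) =
          MvPolynomial.eval y (MvPolynomial.monomial γ 1) * (colForm L k z)⁻¹ := fun γ k => by
      rw [← mul_one (1 : ℂ), ← MvPolynomial.monomial_mul, map_mul, mul_one]
      congr 1
      simp [hy, MvPolynomial.eval_monomial]
    rw [hX, hX]
    have := hz j
    field_simp
  have hsum : ∑ j ∈ a.support, a j * colForm L j z = colForm L i z := by
    have := congrArg (fun w => w ⬝ᵥ z) ha
    simp only [Finsupp.linearCombination_apply, Finsupp.sum, sum_dotProduct,
      smul_dotProduct, smul_eq_mul] at this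
    simpa only [colForm_apply] using this
  rw [map_sub, map_sum, Finset.sum_congr rfl fun j hj => by
    rw [MvPolynomial.smul_eval, hterm j hj]]
  have : ∀ j, a j * (MvPolynomial.eval y (MvPolynomial.monomial α 1) *
      (colForm L j z * (colForm L i z)⁻¹)) = a j * colForm L j z *
        ((colForm L i z)⁻¹ * MvPolynomial.eval y (MvPolynomial.monomial α 1)) := fun j => by ring
  rw [Finset.sum_congr rfl fun j _ => this j, ← Finset.sum_mul, hsum,
    mul_inv_cancel_left₀ (hz i), sub_self]

lemma weight_exchange {M : Type*} [AddCommMonoid M] [IsCancelAdd M] [LinearOrder M]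
    [IsOrderedCancelAddMonoid M] (w : Fin (n + 1) → M)
    {α : Fin (n + 1) →₀ ℕ} {i j : Fin (n + 1)} (hj : j ∈ α.support) (hw : w i < w j) :
    Finsupp.weight w (α - Finsupp.single j 1 + Finsupp.single i 1) < Finsupp.weight w α := by
  rw [← Finsupp.weight_sub_single_add (Finsupp.mem_support_iff.1 hj), map_add,
    Finsupp.weight_single, one_smul]
  exact (add_lt_add_iff_left _).2 hw

lemma degree_exchange {α : Fin (n + 1) →₀ ℕ} {j : Fin (n + 1)} (i : Fin (n + 1))
    (hj : j ∈ α.support) :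
    (α - Finsupp.single j 1 + Finsupp.single i 1).degree = α.degree := by
  have hle : Finsupp.single j 1 ≤ α := by
    rw [Finsupp.single_le_iff]
    exact Nat.one_le_iff_ne_zero.2 (Finsupp.mem_support_iff.1 hj)
  conv_rhs => rw [← tsub_add_cancel_of_le hle]
  simp

/-- Every monomial is congruent, modulo the vanishing ideal, to a combination of monomials of the
same degree and smaller weight whose supports contain no broken circuit. -/
theorem exists_normalForm (L : Matrix (Fin (d + 1)) (Fin (n + 1)) ℂ) (ω : Fin (n + 1) → ℤ)
    (α : Fin (n + 1) →₀ ℕ) :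
    ∃ p : PolyRing n,
      MvPolynomial.monomial α 1 - p ∈ vanishingIdeal (reciprocalLinearSpace L) ∧
      (NoBrokenCircuit L.col ω Set.univ (α.support : Set (Fin (n + 1))) →
        p = MvPolynomial.monomial α 1) ∧
      ∀ β ∈ p.support, NoBrokenCircuit L.col ω Set.univ (β.support : Set (Fin (n + 1))) ∧
        β.degree = α.degree ∧ (β = α ∨ Finsupp.weight ω β < Finsupp.weight ω α) := by
  -- Subtracting the least weight makes all weights nonnegative, so `toNat` preserves strict order
  -- and the rewriting terminates by induction on a natural number.
  obtain ⟨k, -, hk⟩ := Finset.exists_min_image Finset.univ ω Finset.univ_nonempty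
  induction hN : Finsupp.weight (fun i => (ω i - ω k).toNat) α using Nat.strong_induction_on
    generalizing α with
  | _ N ih =>
    subst hN
    by_cases hα : NoBrokenCircuit L.col ω Set.univ (α.support : Set (Fin (n + 1)))
    · refine ⟨MvPolynomial.monomial α 1, by simp, fun _ => rfl, fun β hβ => ?_⟩
      obtain rfl : β = α := by simpa using MvPolynomial.support_monomial_subset hβ
      exact ⟨hα, rfl, Or.inl rfl⟩
    · have hα' := hα
      simp only [NoBrokenCircuit, not_forall, not_not] at hα'
      obtain ⟨i, -, hi⟩ := hα'
      obtain ⟨a, ha, hai⟩ := (Finsupp.mem_span_image_iff_linearCombination ℂ).1 hi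
      have ha' : ∀ j ∈ a.support, j ∈ α.support ∧ ω i < ω j := fun j hj => ha hj
      have hlt : ∀ j ∈ a.support, ω i < ω j := fun j hj => (ha' j hj).2
      have hnf : ∀ j ∈ a.support, ∃ p : PolyRing n,
          MvPolynomial.monomial (α - Finsupp.single j 1 + Finsupp.single i 1) 1 - p ∈
            vanishingIdeal (reciprocalLinearSpace L) ∧
          ∀ β ∈ p.support, NoBrokenCircuit L.col ω Set.univ (β.support : Set (Fin (n + 1))) ∧
            β.degree = α.degree ∧ Finsupp.weight ω β < Finsupp.weight ω α := by
        intro j hj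
        obtain ⟨p, hp, -, hp'⟩ := ih _ (weight_exchange (fun i => (ω i - ω k).toNat) (i := i)
          (ha' j hj).1 (by
            have := hk i (Finset.mem_univ i)
            have := hlt j hj
            omega)) _ rfl
        refine ⟨p, hp, fun β hβ => ?_⟩
        obtain ⟨h1, h2, h3⟩ := hp' β hβ
        have hw := weight_exchange ω (ha' j hj).1 (hlt j hj)
        refine ⟨h1, h2.trans (degree_exchange i (ha' j hj).1), ?_⟩
        rcases h3 with rfl | h3
        · exact hw
        · exact h3.trans hw
      choose! p hp hp' using hnf
      refine ⟨∑ j ∈ a.support, a j • p j, ?_, fun h => absurd h hα, fun β hβ => ?_⟩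
      · rw [← sub_add_sub_cancel (MvPolynomial.monomial α 1) (∑ j ∈ a.support, a j •
          MvPolynomial.monomial (α - Finsupp.single j 1 + Finsupp.single i 1) (1 : ℂ)),
          ← Finset.sum_sub_distrib]
        refine add_mem (monomial_sub_sum_mem_vanishingIdeal hai fun j hj => (ha' j hj).1)
          (sum_mem fun j hj => ?_)
        rw [← smul_sub]
        exact Submodule.smul_of_tower_mem _ (a j) (hp j hj)
      · obtain ⟨j, hj, hβj⟩ := Finset.mem_biUnion.1 (MvPolynomial.support_sum hβ)
        obtain ⟨h1, h2, h3⟩ := hp' j hj β (MvPolynomial.support_smul hβj)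
        exact ⟨h1, h2, Or.inr h3⟩

end VanishingIdeal

/-! ### The initial ideal and its minimal primes -/

section InitialIdeal

variable {d n : ℕ} {L : Matrix (Fin (d + 1)) (Fin (n + 1)) ℂ} {ω : Fin (n + 1) → ℤ}

lemma initialForm_monomial_sub {α : Fin (n + 1) →₀ ℕ} {p : PolyRing n}
    (hp : ∀ β ∈ p.support, Finsupp.weight ω β < Finsupp.weight ω α) :
    initialForm ω (MvPolynomial.monomial α 1 - p) = MvPolynomial.monomial α 1 := by
  have hα : p.coeff α = 0 := by
    by_contra h
    exact lt_irrefl _ (hp α (MvPolynomial.mem_support_iff.2 h))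
  have hcoeff : (MvPolynomial.monomial α (1 : ℂ) - p).coeff α = 1 := by simp [hα]
  have hsupp : ∀ β ∈ (MvPolynomial.monomial α (1 : ℂ) - p).support, β ≠ α →
      Finsupp.weight ω β < Finsupp.weight ω α := by
    intro β hβ hne
    refine hp β (MvPolynomial.mem_support_iff.2 fun h0 => ?_)
    rw [MvPolynomial.mem_support_iff, MvPolynomial.coeff_sub, h0,
      MvPolynomial.coeff_monomial, if_neg hne.symm] at hβ
    simp at hβ
  have hmem : α ∈ (MvPolynomial.monomial α (1 : ℂ) - p).support := by
    rw [MvPolynomial.mem_support_iff, hcoeff]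
    exact one_ne_zero
  have hfilter : (MvPolynomial.monomial α (1 : ℂ) - p).support.filter (fun γ =>
      ∀ β ∈ (MvPolynomial.monomial α (1 : ℂ) - p).support,
        Finsupp.weight ω β ≤ Finsupp.weight ω γ) = {α} := by
    ext γ
    rw [Finset.mem_filter, Finset.mem_singleton]
    constructor
    · rintro ⟨hγ, hmax⟩
      by_contra hne
      exact absurd (hmax α hmem) (not_le.2 (hsupp γ hγ hne))
    · rintro rfl
      refine ⟨hmem, fun β hβ => ?_⟩
      rcases eq_or_ne β γ with rfl | hne
      · exact le_rfl
      · exact (hsupp β hβ hne).le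
  rw [initialForm, hfilter, Finset.sum_singleton, hcoeff]

/-- The normal form of such a monomial cannot contain `α`, so its terms are all strictly lighter and
`y^α` is the initial form of the difference. -/
lemma monomial_mem_initialIdeal {α : Fin (n + 1) →₀ ℕ}
    (hα : ¬ NoBrokenCircuit L.col ω Set.univ (α.support : Set (Fin (n + 1)))) :
    MvPolynomial.monomial α 1 ∈
      initialIdeal ω (vanishingIdeal (reciprocalLinearSpace L)) := by
  obtain ⟨p, hp, -, hp'⟩ := exists_normalForm L ω α
  refine Ideal.subset_span ⟨_, hp, (initialForm_monomial_sub fun β hβ => ?_).symm⟩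
  obtain ⟨h1, -, rfl | h2⟩ := hp' β hβ
  · exact absurd h1 hα
  · exact h2

/-- The support of every term of an initial form contains a broken circuit. -/
lemma not_noBrokenCircuit_of_weight_max (hω : Function.Injective ω) {f : PolyRing n}
    (hf : f ∈ vanishingIdeal (reciprocalLinearSpace L)) {α : Fin (n + 1) →₀ ℕ}
    (hα : α ∈ f.support) (hmax : ∀ β ∈ f.support, Finsupp.weight ω β ≤ Finsupp.weight ω α) :
    ¬ NoBrokenCircuit L.col ω Set.univ (α.support : Set (Fin (n + 1))) := by
  intro hnbc
  choose p hp hp₁ hp₂ using exists_normalForm L ω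
  -- The normal form of `f` lies in the ideal and uses only standard monomials, hence vanishes.
  have hzero : ∑ β ∈ f.support, f.coeff β • p β = 0 := by
    refine eq_zero_of_mem_vanishingIdeal (L := L) hω ?_ fun γ hγ => ?_
    · have hdiff : f - ∑ β ∈ f.support, f.coeff β • p β ∈
          vanishingIdeal (reciprocalLinearSpace L) := by
        have hfs : f = ∑ β ∈ f.support, f.coeff β • MvPolynomial.monomial β (1 : ℂ) := by
          conv_lhs => rw [f.as_sum]
          exact Finset.sum_congr rfl fun β _ => by
            rw [MvPolynomial.smul_monomial, smul_eq_mul, mul_one]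
        have hsub : f - ∑ β ∈ f.support, f.coeff β • p β =
            ∑ β ∈ f.support, f.coeff β • (MvPolynomial.monomial β (1 : ℂ) - p β) := by
          rw [Finset.sum_congr rfl fun β _ => smul_sub _ _ _, Finset.sum_sub_distrib, ← hfs]
        rw [hsub]
        refine sum_mem fun β _ => ?_
        exact Submodule.smul_of_tower_mem _ _ (hp β)
      simpa using sub_mem hf hdiff
    · obtain ⟨β, -, hγβ⟩ := Finset.mem_biUnion.1 (MvPolynomial.support_sum hγ)
      exact (hp₂ β γ (MvPolynomial.support_smul hγβ)).1
  -- Only `p α` contributes to `y^α`: for `β ≠ α`, the terms of `p β` other than `β` are lighter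
  -- than `β`, hence lighter than `α`.
  have hcoeff := congrArg (MvPolynomial.coeff α) hzero
  rw [MvPolynomial.coeff_sum, Finset.sum_eq_single_of_mem α hα, hp₁ α hnbc] at hcoeff
  · exact MvPolynomial.mem_support_iff.1 hα (by simpa using hcoeff)
  · intro β hβ hne
    rw [MvPolynomial.coeff_smul]
    have : (p β).coeff α = 0 := by
      by_contra h
      rcases (hp₂ β α (MvPolynomial.mem_support_iff.2 h)).2.2 with rfl | hlt
      · exact hne rfl
      · exact absurd (hmax β hβ) (not_le.2 hlt)
    rw [this, smul_zero]

lemma initialIdeal_le_coordIdeal (hω : Function.Injective ω) {B : Set (Fin (n + 1))}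
    (hB : NoBrokenCircuit L.col ω Set.univ B) :
    initialIdeal ω (vanishingIdeal (reciprocalLinearSpace L)) ≤ coordIdeal B := by
  refine Ideal.span_le.2 ?_
  rintro _ ⟨f, hf, rfl⟩
  refine sum_mem fun α hα => ?_
  obtain ⟨hα, hmax⟩ := Finset.mem_filter.1 hα
  have hnot := not_noBrokenCircuit_of_weight_max hω hf hα hmax
  obtain ⟨i, hi, hiB⟩ := Set.not_subset.1 fun h => hnot (hB.mono subset_rfl h)
  rw [coordIdeal, MvPolynomial.mem_ideal_span_X_image]
  intro m hm
  obtain rfl : m = α := by simpa using MvPolynomial.support_monomial_subset hm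
  exact ⟨i, hiB, by simpa using hi⟩

/-- The ideal is the kernel of the substitution `y_i ↦ 0` for `i ∉ B`, a map into a domain. -/
lemma coordIdeal_isPrime (B : Set (Fin (n + 1))) : (coordIdeal B).IsPrime := by
  classical
  let φ : PolyRing n →ₐ[ℂ] PolyRing n :=
    MvPolynomial.aeval fun i => if i ∈ B then MvPolynomial.X i else 0
  have hmk : (Ideal.Quotient.mkₐ ℂ (coordIdeal B)).comp φ =
      Ideal.Quotient.mkₐ ℂ (coordIdeal B) := by
    refine MvPolynomial.algHom_ext fun i => ?_
    by_cases hi : i ∈ B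
    · simp [φ, hi]
    · have : Ideal.Quotient.mk (coordIdeal B) (MvPolynomial.X i) = 0 :=
        Ideal.Quotient.eq_zero_iff_mem.2 (Ideal.subset_span ⟨i, hi, rfl⟩)
      simp [φ, hi, this]
  have hker : coordIdeal B = RingHom.ker φ := by
    refine le_antisymm (Ideal.span_le.2 ?_) fun f hf => ?_
    · rintro _ ⟨i, hi, rfl⟩
      have hi : i ∉ B := hi
      simp [φ, hi]
    · have h := DFunLike.congr_fun hmk f
      rw [AlgHom.comp_apply, RingHom.mem_ker.1 hf, map_zero] at h
      exact Ideal.Quotient.eq_zero_iff_mem.1 h.symm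
  rw [hker]
  exact RingHom.ker_isPrime φ

lemma X_mem_coordIdeal_iff {B : Set (Fin (n + 1))} {i : Fin (n + 1)} :
    (MvPolynomial.X i : PolyRing n) ∈ coordIdeal B ↔ i ∉ B := by
  rw [coordIdeal, MvPolynomial.mem_ideal_span_X_image]
  simp [MvPolynomial.support_X, Finsupp.single_apply]

lemma coordIdeal_le_iff {B : Set (Fin (n + 1))} {P : Ideal (PolyRing n)} :
    coordIdeal B ≤ P ↔ ∀ i ∉ B, MvPolynomial.X i ∈ P := by
  rw [coordIdeal, Ideal.span_le, Set.image_subset_iff]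
  rfl

/-- The variables outside a prime containing the initial ideal form an independent set. -/
lemma noBrokenCircuit_of_initialIdeal_le {P : Ideal (PolyRing n)} (hP : P.IsPrime)
    (h : initialIdeal ω (vanishingIdeal (reciprocalLinearSpace L)) ≤ P) :
    NoBrokenCircuit L.col ω Set.univ {i | (MvPolynomial.X i : PolyRing n) ∉ P} := by
  classical
  by_contra hcon
  -- The squarefree product of the variables outside `P` would lie in the initial ideal, hence in
  -- `P`, forcing one of these variables into `P`.
  set S : Finset (Fin (n + 1)) :=
    Finset.univ.filter fun i => (MvPolynomial.X i : PolyRing n) ∉ P with hS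
  have hsupp : ((Finsupp.indicator S fun _ _ => 1 : Fin (n + 1) →₀ ℕ).support :
      Set (Fin (n + 1))) = {i | (MvPolynomial.X i : PolyRing n) ∉ P} := by
    ext i
    simp [hS]
  have hmem := h (monomial_mem_initialIdeal (L := L) (ω := ω) (by rwa [hsupp]))
  have hprod : (MvPolynomial.monomial (Finsupp.indicator S fun _ _ => 1) (1 : ℂ) : PolyRing n) =
      ∏ i ∈ S, MvPolynomial.X i := by
    rw [MvPolynomial.monomial_eq, Finsupp.prod_fintype _ _ (by simp)]
    simp [Finsupp.indicator_apply, Finset.prod_ite_mem, pow_ite]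
  rw [hprod, hP.prod_mem_iff] at hmem
  obtain ⟨i, hi, hiP⟩ := hmem
  exact (Finset.mem_filter.1 hi).2 hiP

/-- Every prime above the initial ideal contains the coordinate prime of some base, and coordinate
primes of distinct bases are incomparable. -/
theorem minimalPrimes_initialIdeal (L : Matrix (Fin (d + 1)) (Fin (n + 1)) ℂ)
    (hω : Function.Injective ω) :
    (initialIdeal ω (vanishingIdeal (reciprocalLinearSpace L))).minimalPrimes =
      {P | ∃ B, IsOmegaBase L ω B ∧ P = coordIdeal B} := by
  have hex : ∀ P : Ideal (PolyRing n), P.IsPrime →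
      initialIdeal ω (vanishingIdeal (reciprocalLinearSpace L)) ≤ P →
      ∃ B, {i | (MvPolynomial.X i : PolyRing n) ∉ P} ⊆ B ∧ IsOmegaBase L ω B := fun P hP hle =>
    ((omegaIndep_iff hω _).2 (noBrokenCircuit_of_initialIdeal_le hP hle)).exists_isOmegaBase
  have hcoord : ∀ (P : Ideal (PolyRing n)) B,
      {i | (MvPolynomial.X i : PolyRing n) ∉ P} ⊆ B → coordIdeal B ≤ P := fun P B hB =>
    coordIdeal_le_iff.2 fun i hi => by
      by_contra hcon
      exact hi (hB hcon)
  have hle : ∀ B, IsOmegaBase L ω B →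
      initialIdeal ω (vanishingIdeal (reciprocalLinearSpace L)) ≤ coordIdeal B := fun B hB =>
    initialIdeal_le_coordIdeal hω ((omegaIndep_iff hω B).1 hB.prop)
  ext P
  constructor
  · rintro ⟨⟨hP, hJP⟩, hmin⟩
    obtain ⟨B, hPB, hB⟩ := hex P hP hJP
    have hBP := hcoord P B hPB
    exact ⟨B, hB, le_antisymm (hmin ⟨coordIdeal_isPrime B, hle B hB⟩ hBP) hBP⟩
  · rintro ⟨B, hB, rfl⟩
    refine ⟨⟨coordIdeal_isPrime B, hle B hB⟩, fun Q ⟨hQ, hJQ⟩ hQB => ?_⟩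
    obtain ⟨B', hQB', hB'⟩ := hex Q hQ hJQ
    have hBB' : B ⊆ B' := fun i hi => hQB' fun hiQ => X_mem_coordIdeal_iff.1 (hQB hiQ) hi
    obtain rfl : B = B' := subset_antisymm hBB' (hB.le_of_ge hB'.prop hBB')
    exact hcoord Q B hQB'

end InitialIdeal

end ReciprocalLinear

namespace ReciprocalLinear

open Module

/-! ### The Hilbert function and the degree -/

section HilbertFunction

variable {d n : ℕ} {L : Matrix (Fin (d + 1)) (Fin (n + 1)) ℂ} {ω : Fin (n + 1) → ℤ}

/-- The Hilbert function of the reciprocal linear space counts monomials whose supports contain no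
broken circuit. -/
theorem hilbertFunction_reciprocalLinearSpace (L : Matrix (Fin (d + 1)) (Fin (n + 1)) ℂ)
    (hω : Function.Injective ω) (q : ℕ) :
    hilbertFunction (vanishingIdeal (reciprocalLinearSpace L)) q =
      Nat.card {α : Fin (n + 1) →₀ ℕ | α.degree = q ∧
        NoBrokenCircuit L.col ω Set.univ (α.support : Set (Fin (n + 1)))} := by
  set A := {α : Fin (n + 1) →₀ ℕ | α.degree = q ∧
        NoBrokenCircuit L.col ω Set.univ (α.support : Set (Fin (n + 1)))} with hA
  have hsupp : ∀ p ∈ MvPolynomial.restrictSupport ℂ A, ∀ β ∈ p.support, β ∈ A :=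
    fun p hp β hβ => (MvPolynomial.mem_restrictSupport_iff ℂ).1 hp hβ
  have hle : MvPolynomial.restrictSupport ℂ A ≤
      MvPolynomial.homogeneousSubmodule (Fin (n + 1)) ℂ q := by
    intro p hp
    rw [MvPolynomial.mem_homogeneousSubmodule]
    intro β hβ
    have := (hsupp p hp β (MvPolynomial.mem_support_iff.2 hβ)).1
    rwa [Finsupp.degree_eq_weight_one] at this
  have hker : ∀ p : MvPolynomial.restrictSupport ℂ A, (Submodule.mkQ
      (((vanishingIdeal (reciprocalLinearSpace L)).restrictScalars ℂ).comap
        (MvPolynomial.homogeneousSubmodule (Fin (n + 1)) ℂ q).subtype) ∘ₗ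
          Submodule.inclusion hle) p = 0 →
      p.1 ∈ vanishingIdeal (reciprocalLinearSpace L) := by
    intro p hp
    exact (Submodule.Quotient.mk_eq_zero (((vanishingIdeal
      (reciprocalLinearSpace L)).restrictScalars ℂ).comap
        (MvPolynomial.homogeneousSubmodule (Fin (n + 1)) ℂ q).subtype)).1 hp
  have hbij : Function.Bijective (Submodule.mkQ
      (((vanishingIdeal (reciprocalLinearSpace L)).restrictScalars ℂ).comap
        (MvPolynomial.homogeneousSubmodule (Fin (n + 1)) ℂ q).subtype) ∘ₗ
          Submodule.inclusion hle) := by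
    -- Injectivity is the independence of standard monomials; surjectivity is the existence of
    -- normal forms.
    constructor
    · refine (injective_iff_map_eq_zero _).2 fun p hp => Subtype.ext ?_
      exact eq_zero_of_mem_vanishingIdeal hω (hker p hp) fun α hα => (hsupp p.1 p.2 α hα).2
    · intro x
      obtain ⟨⟨f, hf⟩, rfl⟩ := Submodule.mkQ_surjective _ x
      choose p hp _ hp₂ using exists_normalForm L ω
      have hfs : f = ∑ β ∈ f.support, f.coeff β • MvPolynomial.monomial β (1 : ℂ) := by
        conv_lhs => rw [f.as_sum]
        exact Finset.sum_congr rfl fun β _ => by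
          rw [MvPolynomial.smul_monomial, smul_eq_mul, mul_one]
      have hsub : f - ∑ β ∈ f.support, f.coeff β • p β =
          ∑ β ∈ f.support, f.coeff β • (MvPolynomial.monomial β (1 : ℂ) - p β) := by
        rw [Finset.sum_congr rfl fun β _ => smul_sub _ _ _, Finset.sum_sub_distrib, ← hfs]
      have hmem : ∑ β ∈ f.support, f.coeff β • p β ∈ MvPolynomial.restrictSupport ℂ A := by
        refine sum_mem fun β hβ => Submodule.smul_mem _ _ ?_
        rw [MvPolynomial.mem_restrictSupport_iff]
        intro γ hγ
        obtain ⟨h1, h2, -⟩ := hp₂ β γ hγ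
        refine ⟨h2.trans ?_, h1⟩
        rw [Finsupp.degree_eq_weight_one]
        exact hf (MvPolynomial.mem_support_iff.1 hβ)
      refine ⟨⟨_, hmem⟩, Eq.symm ((Submodule.Quotient.eq _).2 ?_)⟩
      change f - ∑ β ∈ f.support, f.coeff β • p β ∈ vanishingIdeal (reciprocalLinearSpace L)
      rw [hsub]
      exact sum_mem fun β _ => Submodule.smul_of_tower_mem _ _ (hp β)
  rw [hilbertFunction, ← (LinearEquiv.ofBijective _ hbij).finrank_eq,
    Module.finrank_eq_nat_card_basis (MvPolynomial.basisRestrictSupport ℂ A)]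

/-! ### Counting monomials by support, and the leading coefficient -/

lemma card_filter_support_eq {ι : Type*} [DecidableEq ι] {F : Finset ι}
    (hF : F.Nonempty) {q : ℕ} (hq : F.card ≤ q) :
    ((F.finsuppAntidiag q).filter fun α => α.support = F).card =
      (q - F.card + (F.card - 1)).choose (F.card - 1) := by
  have hsum : ∑ i ∈ F, (Finsupp.indicator F fun _ _ => 1 : ι →₀ ℕ) i = F.card := by
    rw [Finset.sum_congr rfl fun i hi => by rw [Finsupp.indicator_of_mem hi]]
    simp
  have hbij : ((F.finsuppAntidiag q).filter fun α => α.support = F).card =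
      (F.finsuppAntidiag (q - F.card)).card := by
    -- Subtracting 1 at each element of `F` turns exponents with support exactly `F` into arbitrary
    -- exponents on `F`.
    refine Finset.card_nbij' (fun α => α - Finsupp.indicator F fun _ _ => 1)
      (fun β => β + Finsupp.indicator F fun _ _ => 1) ?_ ?_ ?_ ?_
    · intro α hα
      simp only [Finset.coe_filter, Set.mem_ofPred_eq, Finset.mem_finsuppAntidiag] at hα
      obtain ⟨⟨hsumα, -⟩, hsupp⟩ := hα
      simp only [Finset.mem_coe, Finset.mem_finsuppAntidiag]
      constructor
      · rw [← hsumα, ← hsum, ← Finset.sum_tsub_distrib]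
        · rfl
        · intro i hi
          rw [Finsupp.indicator_of_mem hi]
          exact Nat.one_le_iff_ne_zero.2 (Finsupp.mem_support_iff.1 (hsupp ▸ hi))
      · exact Finsupp.support_tsub.trans hsupp.le
    · intro β hβ
      simp only [Finset.mem_coe, Finset.mem_finsuppAntidiag] at hβ
      simp only [Finset.coe_filter, Set.mem_ofPred_eq, Finset.mem_finsuppAntidiag]
      have hsupp : (β + Finsupp.indicator F fun _ _ => 1 : ι →₀ ℕ).support = F := by
        ext i
        by_cases hi : i ∈ F
        · simp [hi]
        · have : i ∉ β.support := fun h => hi (hβ.2 h)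
          simp [hi, Finsupp.notMem_support_iff.1 this]
      refine ⟨⟨?_, hsupp.le⟩, hsupp⟩
      rw [Finset.sum_congr rfl fun i _ => Finsupp.add_apply β _ i, Finset.sum_add_distrib, hsum,
        hβ.1]
      omega
    · intro α hα
      simp only [Finset.coe_filter, Set.mem_ofPred_eq] at hα
      ext i
      by_cases hi : i ∈ F
      · have : α i ≠ 0 := Finsupp.mem_support_iff.1 (hα.2 ▸ hi)
        simp only [Finsupp.add_apply, Finsupp.tsub_apply, Finsupp.indicator_of_mem hi]
        omega
      · simp [hi]
    · intro β hβ
      simp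
  obtain ⟨s, hs⟩ : ∃ s, F.card = s + 1 := ⟨F.card - 1, by have := hF.card_pos; omega⟩
  rw [hbij, Finset.card_finsuppAntidiag_nat_eq_choose, hs, Nat.add_sub_cancel,
    show s + 1 + (q - (s + 1)) - 1 = (q - (s + 1)) + s by omega]
  exact Nat.choose_symm_add

open Classical in
/-- The number of monomials of large degree whose supports belong to a given family of sets. -/
lemma card_support_mem_eq_sum {ι : Type*} [Fintype ι] (p : Finset ι → Prop) {q : ℕ}
    (hq : 0 < q) (hq' : Fintype.card ι ≤ q) :
    Nat.card {α : ι →₀ ℕ | α.degree = q ∧ p α.support} =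
      ∑ F : Finset ι with F.Nonempty ∧ p F, (q - F.card + (F.card - 1)).choose (F.card - 1) := by
  have hset : {α : ι →₀ ℕ | α.degree = q ∧ p α.support} =
      ((Finset.univ.finsuppAntidiag q).filter fun α : ι →₀ ℕ => p α.support : Finset _) := by
    ext α
    simp [Finsupp.degree_eq_sum]
  rw [hset, Nat.card_coe_set_eq, Set.ncard_coe_finset, Finset.card_eq_sum_card_fiberwise
    (f := Finsupp.support) (t := Finset.univ.filter fun F : Finset ι => F.Nonempty ∧ p F)]
  · refine Finset.sum_congr rfl fun F hF => ?_
    obtain ⟨-, hne, hpF⟩ := Finset.mem_filter.1 hF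
    rw [← card_filter_support_eq hne ((Finset.card_le_univ F).trans hq')]
    congr 1
    ext α
    simp only [Finset.mem_filter, Finset.mem_finsuppAntidiag, Finset.subset_univ, and_true]
    constructor
    · rintro ⟨⟨h1, -⟩, h2⟩
      refine ⟨⟨?_, h2.le⟩, h2⟩
      rw [← h1]
      refine Finset.sum_subset (Finset.subset_univ F) fun i _ hi => ?_
      exact Finsupp.notMem_support_iff.1 (h2 ▸ hi)
    · rintro ⟨⟨h1, -⟩, h2⟩
      refine ⟨⟨?_, h2 ▸ hpF⟩, h2⟩
      rw [← h1]
      refine (Finset.sum_subset (Finset.subset_univ F) fun i _ hi => ?_).symm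
      exact Finsupp.notMem_support_iff.1 (h2 ▸ hi)
  · intro α hα
    simp only [Finset.coe_filter, Set.mem_ofPred_eq, Finset.mem_finsuppAntidiag,
      Finset.mem_univ, true_and] at hα ⊢
    refine ⟨?_, hα.2⟩
    by_contra hcon
    rw [Finset.not_nonempty_iff_eq_empty, Finsupp.support_eq_empty] at hcon
    simp [hcon] at hα
    omega

/-- A sum of Hilbert polynomials of coordinate subspaces: the leading coefficient counts the
subspaces of maximal dimension. -/
lemma factorial_mul_leadingCoeff_sum_preHilbertPoly {ι : Type*} (𝓕 : Finset (Finset ι)) {r : ℕ}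
    (h : ∀ F ∈ 𝓕, F.card ≤ r) (hpos : ∀ F ∈ 𝓕, F.Nonempty)
    (hr : (𝓕.filter fun F => F.card = r).Nonempty) :
    (((∑ F ∈ 𝓕, Polynomial.preHilbertPoly ℚ (F.card - 1) F.card).natDegree.factorial : ℚ) *
      (∑ F ∈ 𝓕, Polynomial.preHilbertPoly ℚ (F.card - 1) F.card).leadingCoeff) =
        (𝓕.filter fun F => F.card = r).card := by
  set P := ∑ F ∈ 𝓕, Polynomial.preHilbertPoly ℚ (F.card - 1) F.card with hP
  have hfact : ((r - 1).factorial : ℚ) ≠ 0 := by positivity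
  -- Only sets of size `r` reach degree `r - 1`, each with leading coefficient `1 / (r - 1)!`.
  have hcoeff : P.coeff (r - 1) =
      (𝓕.filter fun F => F.card = r).card * ((r - 1).factorial : ℚ)⁻¹ := by
    rw [hP, Polynomial.finsetSum_coeff, Finset.card_filter, Nat.cast_sum, Finset.sum_mul]
    refine Finset.sum_congr rfl fun F hF => ?_
    have hF0 := (hpos F hF).card_pos
    have hFr := h F hF
    split_ifs with hc
    · subst hc
      rw [Polynomial.coeff_preHilbertPoly_self, Nat.cast_one, one_mul]
    · rw [Nat.cast_zero, zero_mul]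
      refine Polynomial.coeff_eq_zero_of_natDegree_lt ?_
      rw [Polynomial.natDegree_preHilbertPoly]
      omega
  have hcard : ((𝓕.filter fun F => F.card = r).card : ℚ) ≠ 0 := by
    exact_mod_cast hr.card_pos.ne'
  have hdeg : P.natDegree = r - 1 := by
    refine le_antisymm ?_ (Polynomial.le_natDegree_of_ne_zero ?_)
    · refine Polynomial.natDegree_sum_le_of_forall_le _ _ fun F hF => ?_
      rw [Polynomial.natDegree_preHilbertPoly]
      have := h F hF
      omega
    · rw [hcoeff]
      exact mul_ne_zero hcard (inv_ne_zero hfact)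
  rw [Polynomial.leadingCoeff, hdeg, hcoeff]
  field_simp

open Classical in
theorem hasDegree_reciprocalLinearSpace (hL : ∀ i, L.col i ≠ 0) (hω : Function.Injective ω) :
    HasDegree (reciprocalLinearSpace L) {B : Set (Fin (n + 1)) | IsOmegaBase L ω B}.ncard := by
  set r := finrank ℂ (Submodule.span ℂ (Set.range L.col)) with hr
  let p : Finset (Fin (n + 1)) → Prop := fun F =>
    NoBrokenCircuit L.col ω Set.univ (F : Set (Fin (n + 1)))
  set 𝓕 : Finset (Finset (Fin (n + 1))) := Finset.univ.filter fun F => F.Nonempty ∧ p F with h𝓕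
  -- In rank 0 the base would be `∅`, which `𝓕` omits.
  have hrpos : 0 < r := by
    rw [hr, Module.finrank_pos_iff_exists_ne_zero]
    exact ⟨⟨L.col 0, Submodule.subset_span ⟨0, rfl⟩⟩, fun h => hL 0 (congrArg Subtype.val h)⟩
  have hbase : ∀ F : Finset (Fin (n + 1)),
      F ∈ 𝓕.filter (fun F => F.card = r) ↔ IsOmegaBase L ω (F : Set (Fin (n + 1))) := by
    intro F
    rw [isOmegaBase_iff hω, Set.ncard_coe_finset, Finset.mem_filter, h𝓕, Finset.mem_filter]
    constructor
    · rintro ⟨⟨-, -, h1⟩, h2⟩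
      exact ⟨h1, h2⟩
    · rintro ⟨h1, h2⟩
      exact ⟨⟨Finset.mem_univ _, Finset.card_pos.1 (by omega), h1⟩, h2⟩
  have hcount : {B : Set (Fin (n + 1)) | IsOmegaBase L ω B}.ncard =
      (𝓕.filter fun F => F.card = r).card := by
    rw [← Set.ncard_coe_finset, ← Set.ncard_image_of_injective _ Finset.coe_injective]
    congr 1
    ext B
    simp only [Set.mem_ofPred_eq, Set.mem_image, Finset.mem_coe, hbase]
    constructor
    · intro hB
      exact ⟨B.toFinset, by simpa using hB, by simp⟩
    · rintro ⟨F, hF, rfl⟩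
      exact hF
  refine ⟨∑ F ∈ 𝓕, Polynomial.preHilbertPoly ℚ (F.card - 1) F.card, ?_, ?_⟩
  -- For `q ≥ n + 1` the truncated subtraction `q - F.card` is a true one for every face.
  · filter_upwards [Filter.eventually_ge_atTop (n + 1)] with q hq
    rw [hilbertFunction_reciprocalLinearSpace L hω, card_support_mem_eq_sum p (by omega)
      (by simpa using hq), Polynomial.eval_finsetSum, Nat.cast_sum]
    refine Finset.sum_congr rfl fun F _ => ?_
    have hF : F.card ≤ q := (Finset.card_le_univ F).trans (by simpa using hq)
    rw [Polynomial.preHilbertPoly_eq_choose_sub_add ℚ _ hF]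
  · rw [hcount, factorial_mul_leadingCoeff_sum_preHilbertPoly]
    · intro F hF
      have hpF : p F := (Finset.mem_filter.1 hF).2.2
      simpa using hpF.ncard_le hω
    · exact fun F hF => (Finset.mem_filter.1 hF).2.1
    · obtain ⟨B, -, hB⟩ := (omegaIndep_empty hL hω).exists_isOmegaBase
      exact ⟨B.toFinset, (hbase _).2 (by simpa using hB)⟩

end HilbertFunction

end ReciprocalLinear

theorem proposition4p1 (d n : ℕ) (L : Matrix (Fin (d + 1)) (Fin (n + 1)) ℂ)
    (hL : ∀ i, L.col i ≠ 0) (ω : Fin (n + 1) → ℤ) (hω : Function.Injective ω) :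
    ReciprocalLinear.HasDegree (ReciprocalLinear.reciprocalLinearSpace L)
        {B : Set (Fin (n + 1)) | ReciprocalLinear.IsOmegaBase L ω B}.ncard ∧
      (ReciprocalLinear.initialIdeal ω (ReciprocalLinear.vanishingIdeal
          (ReciprocalLinear.reciprocalLinearSpace L))).minimalPrimes =
        {P | ∃ B, ReciprocalLinear.IsOmegaBase L ω B ∧ P = ReciprocalLinear.coordIdeal B} ∧
      ∀ M : Matroid (Fin (n + 1)), M.E = Set.univ →
        (∀ D, M.IsCircuit D ↔ ReciprocalLinear.IsMinimalBrokenCircuit L ω D) →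
        ReciprocalLinear.HasDegree (ReciprocalLinear.reciprocalLinearSpace L)
            {B : Set (Fin (n + 1)) | M.IsBase B}.ncard ∧
          (ReciprocalLinear.initialIdeal ω (ReciprocalLinear.vanishingIdeal
              (ReciprocalLinear.reciprocalLinearSpace L))).minimalPrimes =
            {P | ∃ B, M.IsBase B ∧ P = ReciprocalLinear.coordIdeal B} := by
  have hdeg := ReciprocalLinear.hasDegree_reciprocalLinearSpace hL hω
  have hprimes := ReciprocalLinear.minimalPrimes_initialIdeal L hω
  refine ⟨hdeg, hprimes, fun M hE hM => ?_⟩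
  simp only [ReciprocalLinear.isBase_iff_isOmegaBase hE hM]
  exact ⟨hdeg, hprimes⟩
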